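/- Let $k$ be a finite field with separable closure $K$, $G_k=\mathrm{Gal}(K/k)$, $\ell$ a prime with $\ell\ne\mathrm{char}(k)$, and $\chi_\ell:G_k\to\mathbb Z_\ell^\times\subset\mathbb G_m(\mathbb Q_\ell)$ the $\ell$-adic cyclotomic character. Let $\omega_\ell:\mathbb G_m\to\mathbb G_m$ be the cocharacter $z\mapsto z^{-2}$. A negatively weighted extension of $\mathbb G_m$ is a faithfully flat homomorphism $\pi:G\to\mathbb G_m$ of affine group schemes over $\mathbb Q_\ell$ whose kernel $U$ is prounipotent and such that $H_1(U)$ has only negative weights for the action of $\mathbb G_m$ through $\omega_\ell$ and conjugation by lifts to $G$. The weighted completion of $G_k$ with respect to $\chi_\ell$ and $\omega_\ell$ is a negatively weighted extension $\mathcal A_k\to\mathbb G_m$ with a continuous Zariski-dense homomorphism $\tilde\chi_\ell:G_k\to\mathcal A_k(\mathbb Q_\ell)$ lifting $\chi_\ell$, such that for every negatively weighted extension $G$ and every continuous Zariski-dense $\rho_G:G_k\to G(\mathbb Q_\ell)$ lifting $\chi_\ell$ there is a unique morphism $\phi_G:\mathcal A_k\to G$ with $\rho_G=\phi_G\circ\tilde\chi_\ell$.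 Then $\mathcal A_k=\mathbb G_m$. That is: (1) $\mathbb G_m$ (with the identity $\mathbb G_m\to\mathbb G_m$) and $\chi_\ell$ form the weighted completion of $G_k$ with respect to $\chi_\ell$ and $\omega_\ell$. (2) For every weighted completion $(\mathcal A_k,\tilde\chi_\ell)$, the projection $\mathcal A_k\to\mathbb G_m$ is an isomorphism. Its kernel $\mathcal N_k$ is trivial, and every prounipotent closed subgroup scheme of $\mathcal A_k$ is trivial; in particular the prounipotent radical of $\mathcal A_k$ is trivial. (3) Let $V$ be a finite dimensional $\mathbb G_m$-module over $\mathbb Q_\ell$ all of whose weights with respect to $\omega_\ell$ are nonzero (for example, one of pure weight $m\neq0$), and let $G_k$ act on $V$ through $\chi_\ell$. Then the continuous cohomology $H^1(G_k,V)$ is $0$. -/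

import Mathlib

open scoped TensorProduct LaurentPolynomial

universe u v w x

noncomputable section

namespace WeightedCompletion

/-! An affine (that is, proalgebraic) group scheme `G` over a field `F` is given by its coordinate
ring, a commutative Hopf algebra `A = O(G)` over `F`. For an `F`-algebra `S`, the group `G(S)` is
the set of `F`-algebra homomorphisms `A → S` with the convolution product, `WithConv (A →ₐ[F] S)`.
A homomorphism `G → R` is a bialgebra homomorphism `O(R) →ₐc[F] O(G)`.
The multiplicative group is given by the Laurent polynomials `F[T;T⁻¹]`. -/

section Kernel

variable {F : Type u} [Field F] {R : Type*} [CommRing R] [HopfAlgebra F R]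
  {A : Type*} [CommRing A] [HopfAlgebra F A]

/-- The ideal of `O(G)` that defines the kernel of the homomorphism `G → R` with comorphism `π`:
it is generated by the image of the augmentation ideal of `O(R)`. -/
def kerIdeal (π : R →ₐc[F] A) : Ideal A :=
  Ideal.map (π : R →ₐ[F] A) (RingHom.ker (Bialgebra.counitAlgHom F R))

instance kerIdeal_isCoideal (π : R →ₐc[F] A) :
    ((kerIdeal π).restrictScalars F).IsCoideal where
  counit_eq_zero x hx := by
    have h : kerIdeal π ≤ RingHom.ker (Bialgebra.counitAlgHom F A) := by
      refine Ideal.map_le_iff_le_comap.2 fun r hr => ?_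
      have hr' : Coalgebra.counit (R := F) r = 0 := hr
      change Coalgebra.counit (R := F) (π r) = 0
      rw [CoalgHomClass.counit_comp_apply, hr']
    exact h hx
  map_mkQ_comul_eq_zero x hx := by
    let q := Ideal.Quotient.mkₐ F (kerIdeal π)
    let f : A →ₐ[F] (A ⧸ kerIdeal π) ⊗[F] (A ⧸ kerIdeal π) :=
      (Algebra.TensorProduct.map q q).comp (Bialgebra.comulAlgHom F A)
    have h : kerIdeal π ≤ RingHom.ker f := by
      refine Ideal.map_le_iff_le_comap.2 fun r hr => ?_
      have hr' : Coalgebra.counit (R := F) r = 0 := hr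
      have hq : ∀ s : R, q (π s) = algebraMap F _ (Coalgebra.counit (R := F) s) := by
        intro s
        rw [← q.commutes, ← sub_eq_zero, ← map_sub]
        refine Ideal.Quotient.eq_zero_iff_mem.2 ?_
        have : π s - algebraMap F A (Coalgebra.counit (R := F) s) =
            (π : R →ₐ[F] A) (s - algebraMap F R (Coalgebra.counit (R := F) s)) := by
          rw [map_sub, AlgHom.commutes]
          rfl
        rw [this]
        refine Ideal.mem_map_of_mem _ ?_
        simp [RingHom.mem_ker]
      have hf : ∀ s : R, f (π s) =
          algebraMap F _ (Coalgebra.counit (R := F) s) := by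
        intro s
        have h1 : f (π s) = Algebra.TensorProduct.map (q.comp (π : R →ₐ[F] A))
            (q.comp (π : R →ₐ[F] A)) (Coalgebra.comul (R := F) s) := by
          change Algebra.TensorProduct.map q q (Coalgebra.comul (R := F) (π s)) = _
          rw [← CoalgHomClass.map_comp_comul_apply, Algebra.TensorProduct.map_comp]
          rfl
        have h2 : q.comp (π : R →ₐ[F] A) =
            (Algebra.ofId F _).comp (Bialgebra.counitAlgHom F R) := AlgHom.ext hq
        rw [h1, h2, Algebra.TensorProduct.map_comp]
        change Algebra.TensorProduct.map (Algebra.ofId F _) (Algebra.ofId F _)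
          (Algebra.TensorProduct.map (Bialgebra.counitAlgHom F R) (Bialgebra.counitAlgHom F R)
            (Coalgebra.comul (R := F) s)) = _
        have h3 : Algebra.TensorProduct.map (Bialgebra.counitAlgHom F R)
            (Bialgebra.counitAlgHom F R) (Coalgebra.comul (R := F) s) =
            Coalgebra.counit (R := F) s ⊗ₜ[F] (1 : F) := by
          have e : (Algebra.TensorProduct.map (Bialgebra.counitAlgHom F R)
              (Bialgebra.counitAlgHom F R)).toLinearMap =
              (LinearMap.rTensor F (Coalgebra.counit (R := F) (A := R))) ∘ₗ
                (LinearMap.lTensor R (Coalgebra.counit (R := F) (A := R))) := by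
            ext a b
            simp
          have e' := LinearMap.congr_fun e (Coalgebra.comul (R := F) s)
          simp only [AlgHom.toLinearMap_apply, LinearMap.comp_apply,
            Coalgebra.lTensor_counit_comul, LinearMap.rTensor_tmul] at e'
          exact e'
        rw [h3]
        simp [Algebra.TensorProduct.algebraMap_apply, Algebra.ofId_apply]
      change f (π r) = 0
      rw [hf r, hr', map_zero]
    exact h hx

end Kernel

section Modules

/-- A `G`-module structure on `V`, for the affine group scheme `G` with `O(G) = A`: a right
`A`-comodule structure. -/
structure Coaction (F : Type*) [Field F] (A : Type*) [CommRing A] [Bialgebra F A]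
    (V : Type*) [AddCommGroup V] [Module F V] where
  toFun : V →ₗ[F] V ⊗[F] A
  coassoc : (TensorProduct.assoc F V A A).toLinearMap ∘ₗ LinearMap.rTensor A toFun ∘ₗ toFun =
    LinearMap.lTensor V (Coalgebra.comul (R := F) (A := A)) ∘ₗ toFun
  counit : LinearMap.lTensor V (Coalgebra.counit (R := F) (A := A)) ∘ₗ toFun =
    (TensorProduct.rid F V).symm.toLinearMap

/-- An affine group scheme is prounipotent if every nonzero finite dimensional representation of
it has a nonzero fixed vector. -/
def IsProunipotent (F : Type*) [Field F] (A : Type*) [CommRing A] [Bialgebra F A] : Prop :=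
  ∀ (n : ℕ) (δ : Coaction F A (Fin n → F)), 0 < n → ∃ v : Fin n → F, v ≠ 0 ∧ δ.toFun v = v ⊗ₜ 1

variable {F : Type*} [Field F] {A : Type*} [CommRing A] [Bialgebra F A]
  {V : Type*} [AddCommGroup V] [Module F V]

/-- The action of an `F`-rational point `g` of `G` on a `G`-module. -/
def Coaction.act (δ : Coaction F A V) (g : WithConv (A →ₐ[F] F)) : V →ₗ[F] V :=
  (TensorProduct.rid F V).toLinearMap ∘ₗ LinearMap.lTensor V g.ofConv.toLinearMap ∘ₗ δ.toFun

theorem Coaction.act_one (δ : Coaction F A V) : δ.act 1 = LinearMap.id := by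
  have h : (1 : WithConv (A →ₐ[F] F)).ofConv.toLinearMap = Coalgebra.counit (R := F) (A := A) := by
    ext a
    simp
  rw [Coaction.act, h, δ.counit]
  ext v
  simp

theorem Coaction.act_mul (δ : Coaction F A V) (g h : WithConv (A →ₐ[F] F)) :
    δ.act (g * h) = δ.act g ∘ₗ δ.act h := by
  let m : A ⊗[F] A →ₗ[F] F :=
    LinearMap.mul' F F ∘ₗ TensorProduct.map g.ofConv.toLinearMap h.ofConv.toLinearMap
  have e : (g * h).ofConv.toLinearMap = m ∘ₗ Coalgebra.comul (R := F) (A := A) := rfl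
  have e2 : δ.act g ∘ₗ (TensorProduct.rid F V).toLinearMap ∘ₗ
      LinearMap.lTensor V h.ofConv.toLinearMap =
      (TensorProduct.rid F V).toLinearMap ∘ₗ LinearMap.lTensor V m ∘ₗ
        (TensorProduct.assoc F V A A).toLinearMap ∘ₗ LinearMap.rTensor A δ.toFun := by
    ext v a
    simp only [Coaction.act, TensorProduct.AlgebraTensorModule.curry_apply,
      LinearMap.restrictScalars_self, TensorProduct.curry_apply, LinearMap.comp_apply,
      LinearMap.lTensor_tmul, LinearMap.rTensor_tmul, LinearEquiv.coe_coe,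
      TensorProduct.rid_tmul, map_smul]
    induction δ.toFun v using TensorProduct.induction_on with
    | zero => simp
    | tmul x y => 
      simp only [m, LinearMap.lTensor_tmul, TensorProduct.rid_tmul,
        TensorProduct.assoc_tmul, LinearMap.comp_apply, TensorProduct.map_tmul,
        LinearMap.mul'_apply, smul_smul, mul_comm]
    | add x y hx hy => simp only [map_add, smul_add, hx, hy, TensorProduct.add_tmul]
  have e3 : δ.act g ∘ₗ δ.act h = (δ.act g ∘ₗ (TensorProduct.rid F V).toLinearMap ∘ₗ
      LinearMap.lTensor V h.ofConv.toLinearMap) ∘ₗ δ.toFun := rfl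
  rw [e3, e2, Coaction.act, e, LinearMap.lTensor_comp]
  simp only [LinearMap.comp_assoc]
  rw [← δ.coassoc]

/-- The weight space of weight `n` of a `G`-module `V` with respect to a homomorphism
`𝔾ₘ → G` with comorphism `ω`: the `v` in `V` on which `z` acts through `ω` as `z ^ n`. -/
def Coaction.weightSpace (δ : Coaction F A V) (ω : A →ₐc[F] F[T;T⁻¹]) (n : ℤ) : Submodule F V where
  carrier := {v | LinearMap.lTensor V (ω : A →ₐ[F] F[T;T⁻¹]).toLinearMap (δ.toFun v) =
    v ⊗ₜ LaurentPolynomial.T n}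
  add_mem' {a b} ha hb := by
    simp only [Set.mem_ofPred_eq, map_add, TensorProduct.add_tmul] at *
    rw [ha, hb]
  zero_mem' := by simp
  smul_mem' c x hx := by
    simp only [Set.mem_ofPred_eq, map_smul] at *
    rw [hx, TensorProduct.smul_tmul']

/-- The topological representation of `Γ` on the finite dimensional `G`-module `V` that is
obtained from a homomorphism `Γ → G(F)`. -/
def Coaction.topRep {F : Type u} [NontriviallyNormedField F] [CompleteSpace F]
    {A : Type*} [CommRing A] [Bialgebra F A] {Γ : Type v} [Group Γ]
    {V : Type w} [AddCommGroup V] [Module F V] [Module.Finite F V] [TopologicalSpace V]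
    [IsTopologicalAddGroup V] [ContinuousSMul F V] [T2Space V]
    (δ : Coaction F A V) (ρ : Γ →* WithConv (A →ₐ[F] F)) : TopRep.{w} F Γ :=
  TopRep.of (X := V) <| ContRepresentation.ofMonoidHom
    { toFun γ := LinearMap.toContinuousLinearMap (δ.act (ρ γ))
      map_one' := by
        ext v
        simp [Coaction.act_one]
      map_mul' γ γ' := by
        ext v
        simp [Coaction.act_mul] }

end Modules

section Weights

variable {F : Type u} [Field F] {R : Type*} [CommRing R] [HopfAlgebra F R]
  {A : Type v} [CommRing A] [HopfAlgebra F A]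

/-- For `U = ker (G → R)`, the space `Hom(U, 𝔾ₐ)` of primitive elements of `O(U)`. It is the dual
of `H₁(U)`: the vector group `H₁(U)` is the projective limit of the finite dimensional spaces
`(Hom of E to F)`, with `E` the finite dimensional subspaces of `Hom(U, 𝔾ₐ)`. -/
def homToGa (π : R →ₐc[F] A) : Submodule F (A ⧸ kerIdeal π) where
  carrier := {f | Coalgebra.comul (R := F) f = f ⊗ₜ[F] 1 + 1 ⊗ₜ[F] f}
  add_mem' {a b} ha hb := by
    simp only [Set.mem_ofPred_eq, map_add, TensorProduct.add_tmul, TensorProduct.tmul_add] at *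
    rw [ha, hb]
    abel
  zero_mem' := by simp
  smul_mem' c x hx := by
    simp only [Set.mem_ofPred_eq, map_smul] at *
    rw [hx, smul_add, TensorProduct.smul_tmul', TensorProduct.tmul_smul]

/-- The `f : U → 𝔾ₐ` that factor through the quotient of weight `n` of `H₁(U)`. Here `𝔾ₘ` acts on
`H₁(U)` through `ω : 𝔾ₘ → R` and conjugation by lifts to `G`, so that `f` is to satisfy
`f (g u g⁻¹) = z ^ n * f u` for all points `u` of `U`, `z` of `𝔾ₘ`, and `g` of `G` over `ω(z)`.
Below, `u'` is `g u g⁻¹`. -/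
def homToGaWeight (ω : R →ₐc[F] F[T;T⁻¹]) (π : R →ₐc[F] A) (n : ℤ) :
    Submodule F (A ⧸ kerIdeal π) where
  carrier := {f | f ∈ homToGa π ∧
    ∀ (S : Type (max u v)) [CommRing S] [Algebra F S] (z : F[T;T⁻¹] →ₐ[F] S) (g : A →ₐ[F] S)
      (u u' : (A ⧸ kerIdeal π) →ₐ[F] S),
      g.comp (π : R →ₐ[F] A) = z.comp (ω : R →ₐ[F] F[T;T⁻¹]) →
      WithConv.toConv (u'.comp (Ideal.Quotient.mkₐ F (kerIdeal π))) * WithConv.toConv g =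
        WithConv.toConv g * WithConv.toConv (u.comp (Ideal.Quotient.mkₐ F (kerIdeal π))) →
      u' f = z (LaurentPolynomial.T n) * u f}
  add_mem' {a b} ha hb := by
    refine ⟨add_mem ha.1 hb.1, fun S _ _ z g u u' h1 h2 => ?_⟩
    rw [map_add, map_add, ha.2 S z g u u' h1 h2, hb.2 S z g u u' h1 h2, mul_add]
  zero_mem' := ⟨zero_mem _, fun S _ _ z g u u' _ _ => by simp⟩
  smul_mem' c x hx := by
    refine ⟨Submodule.smul_mem _ _ hx.1, fun S _ _ z g u u' h1 h2 => ?_⟩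
    rw [map_smul, map_smul, hx.2 S z g u u' h1 h2, mul_smul_comm]

/-- `G → R`, with comorphism `π`, is a negatively weighted extension of `R` with respect to the
central cocharacter `ω : 𝔾ₘ → R`: it is faithfully flat, its kernel `U` is prounipotent, and
`H₁(U)` has only negative weights. -/
structure IsNegativelyWeightedExtension (ω : R →ₐc[F] F[T;T⁻¹]) (π : R →ₐc[F] A) : Prop where
  faithfullyFlat : ((π : R →ₐ[F] A) : R →+* A).FaithfullyFlat
  prounipotent : IsProunipotent F (A ⧸ kerIdeal π)
  negative : homToGa π ≤ ⨆ n : {n : ℤ // n < 0}, homToGaWeight ω π n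

end Weights

section Completion

variable {F : Type u} [Field F] [TopologicalSpace F] {R : Type*} [CommRing R] [HopfAlgebra F R]
  {Γ : Type*} [Group Γ] [TopologicalSpace Γ]

/-- `ρ' : Γ → G(F)` is a continuous Zariski-dense homomorphism that lifts `ρ : Γ → R(F)`.
The topology on `G(F)` is that of pointwise convergence on `O(G)`; Zariski-dense means that the
image is not contained in a proper closed subscheme of `G`. -/
structure IsDenseLift {A : Type*} [CommRing A] [HopfAlgebra F A] (π : R →ₐc[F] A)
    (ρ : Γ →* WithConv (R →ₐ[F] F)) (ρ' : Γ →* WithConv (A →ₐ[F] F)) : Prop where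
  continuous : ∀ a : A, Continuous fun γ => (ρ' γ).ofConv a
  dense : ∀ a : A, (∀ γ, (ρ' γ).ofConv a = 0) → a = 0
  lift : ∀ γ r, (ρ' γ).ofConv (π r) = (ρ γ).ofConv r

/-- `(G, ρ')`, with `G → R` of comorphism `π : O(R) → O(G) = A`, is the weighted completion of `Γ`
with respect to `ρ : Γ → R(F)` and `ω : 𝔾ₘ → R`. A morphism `G → G'` is a bialgebra homomorphism
`O(G') → O(G)`. -/
structure IsWeightedCompletion {A : Type v} [CommRing A] [HopfAlgebra F A]
    (ω : R →ₐc[F] F[T;T⁻¹]) (ρ : Γ →* WithConv (R →ₐ[F] F))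
    (π : R →ₐc[F] A) (ρ' : Γ →* WithConv (A →ₐ[F] F)) : Prop where
  extension : IsNegativelyWeightedExtension ω π
  isDenseLift : IsDenseLift π ρ ρ'
  universal : ∀ (B : Type w) [CommRing B] [HopfAlgebra F B] (πB : R →ₐc[F] B)
    (ρB : Γ →* WithConv (B →ₐ[F] F)), IsNegativelyWeightedExtension ω πB → IsDenseLift πB ρ ρB →
      ∃! φ : B →ₐc[F] A, ∀ γ b, (ρB γ).ofConv b = (ρ' γ).ofConv (φ b)

end Completion

section MultiplicativeGroup

/-- The identification of `Fˣ` with `𝔾ₘ(F)`; `z` goes to the evaluation at `T = z`. -/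
def gmPoint (F : Type*) [Field F] : Fˣ →* WithConv (F[T;T⁻¹] →ₐ[F] F) where
  toFun z := WithConv.toConv
    (AddMonoidAlgebra.lift F F ℤ ((Units.coeHom F).comp (zpowersHom Fˣ z)))
  map_one' := by
    refine WithConv.ext (AddMonoidAlgebra.algHom_ext (fun m => ?_) (by ext))
    rw [AlgHom.convOne_apply, AddMonoidAlgebra.counit_single, AddMonoidAlgebra.lift_single]
    simp
  map_mul' x y := by
    refine WithConv.ext (AddMonoidAlgebra.algHom_ext (fun m => ?_) (by ext))
    rw [AddMonoidAlgebra.convMul_algHom_single_one]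
    simp only [AddMonoidAlgebra.lift_single]
    simp [mul_zpow]

/-- The comorphism of `𝔾ₘ → 𝔾ₘ`, `z ↦ z ^ m`. -/
def gmPow (F : Type*) [Field F] (m : ℤ) : F[T;T⁻¹] →ₐc[F] F[T;T⁻¹] :=
  AddMonoidAlgebra.mapDomainBialgHom F (zmultiplesHom ℤ m)

/-- The `ℓ`-adic cyclotomic character `Gal(K/k) → ℤ_ℓˣ ⊆ ℚ_ℓˣ = 𝔾ₘ(ℚ_ℓ)`. -/
def cyclotomic (ℓ : ℕ) [Fact ℓ.Prime] (k K : Type*) [Field k] [Field K] [Algebra k K] :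
    Gal(K/k) →* WithConv (ℚ_[ℓ][T;T⁻¹] →ₐ[ℚ_[ℓ]] ℚ_[ℓ]) :=
  (gmPoint ℚ_[ℓ]).comp <| (Units.map (PadicInt.Coe.ringHom (p := ℓ)).toMonoidHom).comp <|
    (cyclotomicCharacter K ℓ).comp (MulSemiringAction.toRingAut Gal(K/k) K)

end MultiplicativeGroup

end WeightedCompletion

end

noncomputable section

namespace WeightedCompletion

section Comodules

variable {F : Type*} [Field F] {A : Type*} {V W : Type*}
  [AddCommGroup V] [Module F V] [AddCommGroup W] [Module F W]

/-- Linear forms on `A` that separate the elements of `A` from `0` also separate those of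
`V ⊗ A`. -/
theorem tensor_eq_zero_of_forall_lTensor [AddCommGroup A] [Module F A] {ι : Type*}
    (g : ι → A →ₗ[F] F) (hg : ∀ a, (∀ i, g i a = 0) → a = 0) (t : V ⊗[F] A)
    (ht : ∀ i, LinearMap.lTensor V (g i) t = 0) : t = 0 := by
  classical
  let b := Module.Basis.ofVectorSpace F V
  apply (TensorProduct.equivFinsuppOfBasisLeft b).injective
  rw [map_zero]
  ext j
  refine hg _ fun i => ?_
  have h : g i ∘ₗ Finsupp.lapply j ∘ₗ
      (TensorProduct.equivFinsuppOfBasisLeft (N := A) b).toLinearMap =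
      Finsupp.lapply j ∘ₗ (TensorProduct.equivFinsuppOfBasisLeft (N := F) b).toLinearMap ∘ₗ
        LinearMap.lTensor V (g i) := by
    ext v a
    simp
  have := LinearMap.congr_fun h t
  simpa [ht i] using this

/-- An element of `V ⊗ A` all of whose contractions with linear forms on `A` lie in the range of
`j : W → V` lies in the range of `W ⊗ A`. -/
theorem mem_range_rTensor_of_forall_lTensor [AddCommGroup A] [Module F A] (j : W →ₗ[F] V)
    (t : V ⊗[F] A)
    (ht : ∀ φ : A →ₗ[F] F, TensorProduct.rid F V (LinearMap.lTensor V φ t) ∈ j.range) :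
    t ∈ (LinearMap.rTensor A j).range := by
  classical
  let b := Module.Basis.ofVectorSpace F A
  have key : ∀ i, TensorProduct.equivFinsuppOfBasisRight b t i =
      TensorProduct.rid F V (LinearMap.lTensor V (b.coord i) t) := by
    intro i
    have h : Finsupp.lapply i ∘ₗ (TensorProduct.equivFinsuppOfBasisRight (M := V) b).toLinearMap =
        (TensorProduct.rid F V).toLinearMap ∘ₗ LinearMap.lTensor V (b.coord i) := by
      ext v a
      simp
    exact LinearMap.congr_fun h t
  rw [← (TensorProduct.equivFinsuppOfBasisRight b).symm_apply_apply t,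
    TensorProduct.equivFinsuppOfBasisRight_symm_apply]
  refine Submodule.sum_mem _ fun i _ => ?_
  obtain ⟨y, hy⟩ := ht (b.coord i)
  exact ⟨y ⊗ₜ b i, by simp [key, hy]⟩

variable [CommRing A] [Bialgebra F A]

/-- A linear map `d : W → W ⊗ A` that is compatible with a comodule structure on `V` along an
injective linear map `W → V` is a comodule structure. -/
def Coaction.ofInjective (δ : Coaction F A V) (j : W →ₗ[F] V) (hj : Function.Injective j)
    (d : W →ₗ[F] W ⊗[F] A) (hd : LinearMap.rTensor A j ∘ₗ d = δ.toFun ∘ₗ j) :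
    Coaction F A W where
  toFun := d
  coassoc := by
    have hinj : Function.Injective (LinearMap.rTensor (A ⊗[F] A) j) :=
      Module.Flat.rTensor_preserves_injective_linearMap j hj
    have h1 : LinearMap.rTensor (A ⊗[F] A) j ∘ₗ (TensorProduct.assoc F W A A).toLinearMap =
        (TensorProduct.assoc F V A A).toLinearMap ∘ₗ
          LinearMap.rTensor A (LinearMap.rTensor A j) := by
      ext
      simp
    rw [← LinearMap.cancel_left hinj, ← LinearMap.comp_assoc, h1, LinearMap.comp_assoc,
      ← LinearMap.comp_assoc d, ← LinearMap.rTensor_comp, hd, LinearMap.rTensor_comp,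
      LinearMap.comp_assoc, hd, ← LinearMap.comp_assoc d, LinearMap.rTensor_comp_lTensor,
      ← LinearMap.lTensor_comp_rTensor, LinearMap.comp_assoc, hd]
    simp only [← LinearMap.comp_assoc]
    rw [← δ.coassoc]
    simp only [LinearMap.comp_assoc]
  counit := by
    have hinj : Function.Injective (LinearMap.rTensor F j) :=
      Module.Flat.rTensor_preserves_injective_linearMap j hj
    rw [← LinearMap.cancel_left hinj, ← LinearMap.comp_assoc, LinearMap.rTensor_comp_lTensor,
      ← LinearMap.lTensor_comp_rTensor, LinearMap.comp_assoc, hd, ← LinearMap.comp_assoc,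
      δ.counit]
    ext y
    simp

/-- The contractions of `δ v` with linear forms on `A`: this is the subcomodule generated by `v`. -/
def Coaction.orbit (δ : Coaction F A V) (v : V) : Submodule F V :=
  LinearMap.range ((TensorProduct.rid F V).toLinearMap ∘ₗ
    (LinearMap.applyₗ (δ.toFun v)) ∘ₗ LinearMap.lTensorHom V (N := A) (P := F))

theorem Coaction.mem_orbit (δ : Coaction F A V) {v y : V} :
    y ∈ δ.orbit v ↔
      ∃ φ : A →ₗ[F] F, TensorProduct.rid F V (LinearMap.lTensor V φ (δ.toFun v)) = y :=
  Iff.rfl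

theorem Coaction.self_mem_orbit (δ : Coaction F A V) (v : V) : v ∈ δ.orbit v :=
  δ.mem_orbit.2 ⟨Coalgebra.counit, by
    have := LinearMap.congr_fun δ.counit v
    simp_all⟩

instance Coaction.finite_orbit (δ : Coaction F A V) (v : V) : Module.Finite F (δ.orbit v) := by
  classical
  obtain ⟨s, hs⟩ := TensorProduct.exists_finset (δ.toFun v)
  have hle : δ.orbit v ≤ Submodule.span F (s.image Prod.fst : Finset V) := by
    rintro y ⟨φ, rfl⟩
    change TensorProduct.rid F V (LinearMap.lTensor V φ (δ.toFun v)) ∈ _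
    rw [hs, map_sum, map_sum]
    refine Submodule.sum_mem _ fun p hp => ?_
    rw [LinearMap.lTensor_tmul, TensorProduct.rid_tmul]
    exact Submodule.smul_mem _ _ (Submodule.subset_span (by
      simpa using ⟨p.2, hp⟩))
  exact Submodule.finiteDimensional_of_le hle

theorem Coaction.toFun_mem_of_mem_orbit (δ : Coaction F A V) {v y : V} (hy : y ∈ δ.orbit v) :
    δ.toFun y ∈ (LinearMap.rTensor A (δ.orbit v).subtype).range := by
  obtain ⟨φ, rfl⟩ := δ.mem_orbit.1 hy
  refine mem_range_rTensor_of_forall_lTensor _ _ fun ψ => ?_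
  rw [Submodule.range_subtype, δ.mem_orbit]
  refine ⟨LinearMap.mul' F F ∘ₗ TensorProduct.map ψ φ ∘ₗ Coalgebra.comul, ?_⟩
  have h1 : δ.toFun ∘ₗ (TensorProduct.rid F V).toLinearMap ∘ₗ LinearMap.lTensor V φ =
      (TensorProduct.rid F (V ⊗[F] A)).toLinearMap ∘ₗ LinearMap.lTensor (V ⊗[F] A) φ ∘ₗ
        LinearMap.rTensor A δ.toFun := by
    ext
    simp
  have h2 : (TensorProduct.rid F V).toLinearMap ∘ₗ LinearMap.lTensor V ψ ∘ₗ
      (TensorProduct.rid F (V ⊗[F] A)).toLinearMap ∘ₗ LinearMap.lTensor (V ⊗[F] A) φ =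
      (TensorProduct.rid F V).toLinearMap ∘ₗ
        LinearMap.lTensor V (LinearMap.mul' F F ∘ₗ TensorProduct.map ψ φ) ∘ₗ
        (TensorProduct.assoc F V A A).toLinearMap := by
    ext
    simp [smul_smul, mul_comm]
  have h3 := LinearMap.congr_fun h1 (δ.toFun v)
  have h4 := LinearMap.congr_fun h2 (LinearMap.rTensor A δ.toFun (δ.toFun v))
  have h5 := LinearMap.congr_fun δ.coassoc v
  simp only [LinearMap.comp_apply, LinearEquiv.coe_coe] at h3 h4 h5
  rw [h3, h4, h5, ← LinearMap.lTensor_comp_apply, LinearMap.comp_assoc]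

/-- Every nonzero comodule of a prounipotent group scheme has a nonzero fixed vector. -/
theorem IsProunipotent.exists_fixed (hA : IsProunipotent F A) (δ : Coaction F A V) {v : V}
    (hv : v ≠ 0) : ∃ y : V, y ≠ 0 ∧ δ.toFun y = y ⊗ₜ 1 := by
  let E := δ.orbit v
  let e := (Module.finBasis F E).equivFun
  let j : (Fin (Module.finrank F E) → F) →ₗ[F] V := E.subtype ∘ₗ e.symm.toLinearMap
  have hj : Function.Injective j := E.injective_subtype.comp e.symm.injective
  have hrange : ∀ y, δ.toFun (j y) ∈ (LinearMap.rTensor A j).range := by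
    intro y
    have h := δ.toFun_mem_of_mem_orbit (e.symm y).2
    have h2 : E.subtype = j ∘ₗ e.toLinearMap := by ext; simp [j]
    rw [show (δ.orbit v).subtype = j ∘ₗ e.toLinearMap from h2, LinearMap.rTensor_comp] at h
    exact LinearMap.range_comp_le_range _ _ h
  have hι : Function.Injective (LinearMap.rTensor A j) :=
    Module.Flat.rTensor_preserves_injective_linearMap j hj
  let d := (LinearEquiv.ofInjective _ hι).symm.toLinearMap ∘ₗ
    LinearMap.codRestrict _ (δ.toFun ∘ₗ j) hrange
  have hd : LinearMap.rTensor A j ∘ₗ d = δ.toFun ∘ₗ j := by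
    refine LinearMap.ext fun y => ?_
    exact congrArg Subtype.val ((LinearEquiv.ofInjective _ hι).apply_symm_apply
      ⟨δ.toFun (j y), hrange y⟩)
  have hpos : 0 < Module.finrank F E := by
    have : Nontrivial E := ⟨⟨⟨v, δ.self_mem_orbit v⟩, 0, fun h => hv (congrArg Subtype.val h)⟩⟩
    exact Module.finrank_pos
  obtain ⟨y, hy0, hy⟩ := hA _ (δ.ofInjective j hj d hd) hpos
  refine ⟨j y, (map_ne_zero_iff j hj).2 hy0, ?_⟩
  have h := LinearMap.congr_fun hd y
  change d y = _ at hy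
  rw [LinearMap.comp_apply, hy] at h
  simpa using h.symm

end Comodules

section Prounipotent

variable {F : Type*} [Field F] {A : Type*} [CommRing A] [Bialgebra F A]

variable (F A) in
/-- The projection of `O(G)` onto the augmentation ideal. -/
def augmentationProj : A →ₗ[F] LinearMap.ker (Coalgebra.counit (R := F) (A := A)) where
  toFun a := ⟨a - algebraMap F A (Coalgebra.counit (R := F) a), by simp⟩
  map_add' a b := by ext; simp; ring
  map_smul' c a := by ext; simp [Algebra.smul_def, mul_sub]

theorem coe_augmentationProj (a : A) : (augmentationProj F A a : A) =
    a - algebraMap F A (Coalgebra.counit (R := F) a) := rfl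

theorem rTensor_subtype_augmentationProj (a : A) :
    LinearMap.rTensor A (LinearMap.ker (Coalgebra.counit (R := F) (A := A))).subtype
      (LinearMap.rTensor A (augmentationProj F A) (Coalgebra.comul (R := F) a)) =
      Coalgebra.comul (R := F) a - 1 ⊗ₜ a := by
  have h : (LinearMap.ker (Coalgebra.counit (R := F) (A := A))).subtype ∘ₗ
      augmentationProj F A = LinearMap.id - Algebra.linearMap F A ∘ₗ Coalgebra.counit := by
    ext a
    simp [coe_augmentationProj]
  rw [← LinearMap.rTensor_comp_apply, h, LinearMap.rTensor_sub, LinearMap.sub_apply,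
    LinearMap.rTensor_comp_apply, Coalgebra.rTensor_counit_comul]
  simp

variable (F A) in
/-- The comodule `O(G) / F`, realised on the augmentation ideal. -/
def augmentationCoaction : Coaction F A (LinearMap.ker (Coalgebra.counit (R := F) (A := A))) :=
  let s := (LinearMap.ker (Coalgebra.counit (R := F) (A := A))).subtype
  let p := augmentationProj F A
  have hps : ∀ a, p (s a) = a := by
    rintro ⟨a, ha⟩
    rw [LinearMap.mem_ker] at ha
    ext
    simp [p, s, coe_augmentationProj, ha]
  have hp1 : p 1 = 0 := by
    ext
    simp [p, coe_augmentationProj]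
  have hp : LinearMap.rTensor A p ∘ₗ Coalgebra.comul ∘ₗ s ∘ₗ p =
      LinearMap.rTensor A p ∘ₗ Coalgebra.comul := by
    ext1 a
    simp [s, p, coe_augmentationProj, Algebra.algebraMap_eq_smul_one,
      Algebra.TensorProduct.one_def]
    simp [p, hp1]
  { toFun := LinearMap.rTensor A p ∘ₗ Coalgebra.comul ∘ₗ s
    coassoc := by
      have h1 : LinearMap.rTensor A (LinearMap.rTensor A p ∘ₗ Coalgebra.comul ∘ₗ s) ∘ₗ
          LinearMap.rTensor A p = LinearMap.rTensor A (LinearMap.rTensor A p) ∘ₗ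
            LinearMap.rTensor A Coalgebra.comul := by
        rw [← LinearMap.rTensor_comp, ← LinearMap.rTensor_comp, ← hp]
        simp only [LinearMap.comp_assoc]
      have h2 : (TensorProduct.assoc F _ A A).toLinearMap ∘ₗ
          LinearMap.rTensor A (LinearMap.rTensor A p) =
          LinearMap.rTensor (A ⊗[F] A) p ∘ₗ (TensorProduct.assoc F A A A).toLinearMap := by
        ext
        simp
      rw [← LinearMap.comp_assoc _ _ (LinearMap.rTensor A _), h1]
      simp only [← LinearMap.comp_assoc]
      rw [h2, LinearMap.lTensor_comp_rTensor, ← LinearMap.rTensor_comp_lTensor]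
      simp only [LinearMap.comp_assoc]
      rw [← LinearMap.comp_assoc s _ (LinearMap.lTensor A _), ← Coalgebra.coassoc]
      simp only [LinearMap.comp_assoc]
    counit := by
      rw [← LinearMap.comp_assoc, LinearMap.lTensor_comp_rTensor, ← LinearMap.rTensor_comp_lTensor,
        LinearMap.comp_assoc, ← LinearMap.comp_assoc s, Coalgebra.lTensor_counit_comp_comul]
      ext1 a
      simp [hps] }

/-- A prounipotent group scheme without nonzero homomorphisms to `𝔾ₐ` is trivial. -/
theorem IsProunipotent.eq_algebraMap_counit (hA : IsProunipotent F A)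
    (hprim : ∀ f : A, Coalgebra.comul (R := F) f = f ⊗ₜ[F] 1 + 1 ⊗ₜ[F] f → f = 0) (a : A) :
    a = algebraMap F A (Coalgebra.counit (R := F) a) := by
  by_contra ha
  have hne : augmentationProj F A a ≠ 0 := fun h => ha (by
    have := congrArg Subtype.val h
    simpa [coe_augmentationProj, sub_eq_zero] using this)
  obtain ⟨y, hy0, hy⟩ := hA.exists_fixed (augmentationCoaction F A) hne
  refine hy0 (Subtype.ext (hprim _ ?_))
  have h := rTensor_subtype_augmentationProj (F := F) (y : A)
  change LinearMap.rTensor A (LinearMap.ker (Coalgebra.counit (R := F) (A := A))).subtype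
    ((augmentationCoaction F A).toFun y) = _ at h
  rw [hy, LinearMap.rTensor_tmul, Submodule.subtype_apply] at h
  exact (sub_eq_iff_eq_add.1 h.symm)

end Prounipotent

section Extensions

variable {F : Type u} [Field F] {R : Type*} [CommRing R] [HopfAlgebra F R]
  {A : Type v} [CommRing A] [HopfAlgebra F A]

/-- A group scheme with a dense abelian group of rational points is commutative. -/
theorem isCocomm_of_dense {Γ : Type*} [Group Γ] [IsMulCommutative Γ] (ρ : Γ →* WithConv (A →ₐ[F] F))
    (h : ∀ a : A, (∀ γ, (ρ γ).ofConv a = 0) → a = 0) : Coalgebra.IsCocomm F A where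
  comm_comp_comul := by
    ext1 a
    rw [← sub_eq_zero]
    refine tensor_eq_zero_of_forall_lTensor (fun γ => (ρ γ).ofConv.toLinearMap) h _ fun γ => ?_
    apply (TensorProduct.rid F A).injective
    rw [map_zero]
    refine h _ fun γ' => ?_
    have e : ∀ t : A ⊗[F] A, (ρ γ').ofConv (TensorProduct.rid F A
        (LinearMap.lTensor A (ρ γ).ofConv.toLinearMap t)) =
        LinearMap.mul' F F (TensorProduct.map (ρ γ').ofConv.toLinearMap
          (ρ γ).ofConv.toLinearMap t) := by
      intro t
      induction t with
      | zero => simp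
      | add x y hx hy => simp only [map_add, hx, hy]
      | tmul x y => simp [mul_comm]
    have e' : ∀ t : A ⊗[F] A, LinearMap.mul' F F (TensorProduct.map (ρ γ').ofConv.toLinearMap
          (ρ γ).ofConv.toLinearMap (TensorProduct.comm F A A t)) =
          LinearMap.mul' F F (TensorProduct.map (ρ γ).ofConv.toLinearMap
          (ρ γ').ofConv.toLinearMap t) := by
      intro t
      induction t with
      | zero => simp
      | add x y hx hy => simp only [map_add, hx, hy]
      | tmul x y => simp [mul_comm]
    simp only [LinearMap.comp_apply, LinearEquiv.coe_coe, map_sub, e, e']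
    rw [sub_eq_zero]
    change (ρ γ * ρ γ').ofConv a = (ρ γ' * ρ γ).ofConv a
    rw [← map_mul, ← map_mul, mul_comm']

/-- In a commutative extension `G` of `R`, the homomorphisms from the kernel to `𝔾ₐ` have no
nonzero weight `n`, as soon as some `z` with `z ^ n ≠ 1` has the property that `ω(z)` lifts to a
rational point of `G`. -/
theorem homToGaWeight_eq_bot [Coalgebra.IsCocomm F A] (ω : R →ₐc[F] F[T;T⁻¹]) (π : R →ₐc[F] A)
    (n : ℤ) (z : F[T;T⁻¹] →ₐ[F] F) (g : A →ₐ[F] F)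
    (hg : g.comp (π : R →ₐ[F] A) = z.comp (ω : R →ₐ[F] F[T;T⁻¹]))
    (hz : z (LaurentPolynomial.T n) ≠ 1) : homToGaWeight ω π n = ⊥ := by
  rw [eq_bot_iff]
  rintro f ⟨-, hf⟩
  let S := A ⧸ kerIdeal π
  let e : S ≃ₐ[F] ULift.{u} S := ULift.algEquiv.symm
  have h := hf (ULift.{u} S) ((Algebra.ofId F _).comp z) ((Algebra.ofId F _).comp g)
    e e (by rw [AlgHom.comp_assoc, hg, AlgHom.comp_assoc]) (mul_comm _ _)
  have h' : z (LaurentPolynomial.T n) • f = f := by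
    apply e.injective
    rw [map_smul, Algebra.smul_def]
    exact h.symm
  rw [← sub_eq_zero, ← one_smul F f, smul_smul, ← sub_smul, mul_one] at h'
  exact (smul_eq_zero.1 h').resolve_left (sub_ne_zero.2 hz)

/-- Points of an affine group scheme are invertible. -/
theorem toConv_comp_antipode_mul {S : Type*} [CommRing S] [Algebra F S] (f : A →ₐ[F] S) :
    WithConv.toConv (f.comp (HopfAlgebra.antipodeAlgHom F A)) * WithConv.toConv f = 1 := by
  have h := congrArg WithConv.toConv (AlgHom.comp_convMul_distrib f
    (WithConv.toConv (HopfAlgebra.antipodeAlgHom F A)) (WithConv.toConv (AlgHom.id F A)))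
  rw [AlgHom.antipode_id_cancel] at h
  refine Eq.trans h.symm (WithConv.ext (AlgHom.ext fun a => ?_))
  exact f.commutes _

theorem isUnit_toConv {S : Type*} [CommRing S] [Algebra F S] (f : A →ₐ[F] S) :
    IsUnit (WithConv.toConv f) := by
  have h1 := toConv_comp_antipode_mul f
  have h2 := toConv_comp_antipode_mul (f.comp (HopfAlgebra.antipodeAlgHom F A))
  refine ⟨⟨_, _, ?_, h1⟩, rfl⟩
  rwa [left_inv_eq_right_inv h2 h1] at h2

/-- A faithfully flat homomorphism of affine group schemes with trivial kernel is an
isomorphism. -/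
theorem bijective_of_kerIdeal_eq (π : R →ₐc[F] A)
    (hπ : ((π : R →ₐ[F] A) : R →+* A).FaithfullyFlat)
    (h : kerIdeal π = RingHom.ker (Bialgebra.counitAlgHom F A)) : Function.Bijective π := by
  algebraize [((π : R →ₐ[F] A) : R →+* A)]
  have hπa : ∀ r, algebraMap R A r = π r := fun r => rfl
  have : IsScalarTower F R A := IsScalarTower.of_algebraMap_eq fun c => by
    rw [hπa, AlgHomClass.commutes]
  let i₁ : A →ₐ[F] A ⊗[R] A :=
    (Algebra.TensorProduct.includeLeft (R := R) (S := R)).restrictScalars F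
  let i₂ : A →ₐ[F] A ⊗[R] A := (Algebra.TensorProduct.includeRight (R := R)).restrictScalars F
  let d := WithConv.toConv i₁ *
    WithConv.toConv (i₂.comp (HopfAlgebra.antipodeAlgHom F A))
  have hd : d * WithConv.toConv i₂ = WithConv.toConv i₁ := by
    rw [mul_assoc, toConv_comp_antipode_mul, mul_one]
  have hi : i₁.comp (π : R →ₐ[F] A) = i₂.comp (π : R →ₐ[F] A) := by
    ext r
    change (algebraMap R A r) ⊗ₜ[R] (1 : A) = (1 : A) ⊗ₜ[R] (algebraMap R A r)
    rw [Algebra.algebraMap_eq_smul_one, TensorProduct.smul_tmul]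
  have hdπ : WithConv.toConv (d.ofConv.comp (π : R →ₐ[F] A)) = 1 := by
    have h1 := AlgHom.convMul_comp_bialgHom_distrib d (WithConv.toConv i₂) π
    rw [hd, WithConv.ofConv_toConv, WithConv.ofConv_toConv, hi] at h1
    have h2 := congrArg WithConv.toConv h1
    rw [WithConv.toConv_ofConv] at h2
    exact (isUnit_toConv _).mul_eq_right.1 h2.symm
  have hker : kerIdeal π ≤ RingHom.ker d.ofConv := by
    refine Ideal.map_le_iff_le_comap.2 fun r hr => ?_
    have h1 := congrArg (fun f => f.ofConv r) hdπ
    have hr' : Coalgebra.counit (R := F) r = 0 := hr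
    change d.ofConv (π r) = 0
    change d.ofConv (π r) = algebraMap F _ (Coalgebra.counit (R := F) r) at h1
    rw [h1, hr', map_zero]
  rw [h] at hker
  have hd1 : d = 1 := by
    refine WithConv.ext (AlgHom.ext fun a => ?_)
    have h1 : a - algebraMap F A (Coalgebra.counit (R := F) a) ∈
        RingHom.ker (Bialgebra.counitAlgHom F A) := by simp [RingHom.mem_ker]
    have h2 := hker h1
    rw [RingHom.mem_ker, map_sub, AlgHom.commutes, sub_eq_zero] at h2
    exact h2
  have hi' : i₁ = i₂ := by
    rw [hd1, one_mul] at hd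
    exact (WithConv.toConv_injective hd).symm
  have heff := (Algebra.IsEffective.of_faithfullyFlat R A).eqLocus_includeLeft_includeRight
  refine ⟨FaithfulSMul.algebraMap_injective R A, fun a => ?_⟩
  have ha : a ∈ Set.range (algebraMap R A) := by
    rw [← heff]
    exact DFunLike.congr_fun hi' a
  exact ha

end Extensions

section Frobenius

variable (k : Type*) (K : Type*) [Field k] [Finite k] [Field K] [Algebra k K]

theorem mem_range_algebraMap_of_pow_card_eq (x : K) (hx : x ^ Nat.card k = x) :
    x ∈ (algebraMap k K).range := by
  let := Fintype.ofFinite k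
  rw [Nat.card_eq_fintype_card] at hx
  have hs : (Polynomial.X ^ Fintype.card k - Polynomial.X : Polynomial k).Splits := by
    simpa using Polynomial.IsSplittingField.splits k
      (Polynomial.X ^ Fintype.card k - Polynomial.X : Polynomial k)
  refine hs.mem_range_of_isRoot
    (FiniteField.X_pow_card_sub_X_ne_zero k Fintype.one_lt_card) ?_
  simp [hx]

variable [IsSepClosure k K]

/-- The arithmetic Frobenius automorphism. -/
def frobenius : Gal(K/k) :=
  have : IsGalois k K := inferInstance
  letI := Fintype.ofFinite k
  FiniteField.frobeniusAlgEquivOfAlgebraic k K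

variable {k K} in
theorem frobenius_apply (x : K) : frobenius k K x = x ^ Nat.card k := by
  let := Fintype.ofFinite k
  rw [Nat.card_eq_fintype_card]
  have : IsGalois k K := inferInstance
  exact congrFun (FiniteField.coe_frobeniusAlgEquivOfAlgebraic k K) x

theorem topologicalClosure_zpowers_frobenius :
    (Subgroup.zpowers (frobenius k K)).topologicalClosure = ⊤ := by
  have : IsGalois k K := inferInstance
  let H : ClosedSubgroup Gal(K/k) :=
    ⟨(Subgroup.zpowers (frobenius k K)).topologicalClosure,
      Subgroup.isClosed_topologicalClosure _⟩
  have h := InfiniteGalois.fixingSubgroup_fixedField H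
  have h2 : IntermediateField.fixedField H.toSubgroup = ⊥ := by
    rw [eq_bot_iff]
    intro x hx
    have hx' : frobenius k K x = x :=
      hx ⟨frobenius k K, Subgroup.le_topologicalClosure _ (Subgroup.mem_zpowers _)⟩
    rw [frobenius_apply] at hx'
    exact mem_range_algebraMap_of_pow_card_eq k K x hx'
  change H.toSubgroup = ⊤
  rw [← h]
  rw [h2, IntermediateField.fixingSubgroup_bot]

instance isMulCommutative_gal : IsMulCommutative Gal(K/k) where
  is_comm.comm σ τ := by
    have : IsGalois k K := inferInstance
    let := Subgroup.commGroupTopologicalClosure (Subgroup.zpowers (frobenius k K))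
      (fun a b => mul_comm' a b)
    have h : ∀ γ, γ ∈ (Subgroup.zpowers (frobenius k K)).topologicalClosure := fun γ => by
      rw [topologicalClosure_zpowers_frobenius]
      trivial
    exact congrArg Subtype.val (mul_comm (⟨σ, h σ⟩ :
      (Subgroup.zpowers (frobenius k K)).topologicalClosure) ⟨τ, h τ⟩)

theorem cyclotomicCharacter_frobenius (ℓ : ℕ) [Fact ℓ.Prime] (hℓ : (ℓ : k) ≠ 0) :
    (cyclotomicCharacter K ℓ (MulSemiringAction.toRingAut Gal(K/k) K (frobenius k K)) : ℤ_[ℓ]) =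
      Nat.card k := by
  have : IsSepClosed K := IsSepClosure.sep_closed k
  have : NeZero (ℓ : K) := ⟨by
    rw [← map_natCast (algebraMap k K)]
    exact (map_ne_zero _).2 hℓ⟩
  refine PadicInt.ext_of_toZModPow.1 fun n => ?_
  rw [cyclotomicCharacter.toZModPow, map_natCast]
  symm
  apply modularCyclotomicCharacter.unique
  intro t ht
  rw [ZMod.val_natCast]
  have ht' : t ^ (ℓ ^ n) = 1 := ht
  have h2 : t ^ (Nat.card k % ℓ ^ n) = t ^ Nat.card k := (pow_eq_pow_mod _ ht').symm
  rw [← Units.val_pow_eq_pow_val, h2, Units.val_pow_eq_pow_val]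
  exact frobenius_apply (t : K)

end Frobenius

section Points

theorem gmPoint_T {F : Type*} [Field F] (z : Fˣ) (n : ℤ) :
    (gmPoint F z).ofConv (LaurentPolynomial.T n) = (z : F) ^ n := by
  change AddMonoidAlgebra.lift F F ℤ _ (AddMonoidAlgebra.single n 1) = _
  rw [AddMonoidAlgebra.lift_single]
  simp

theorem eq_zero_of_gmPoint {F : Type*} [Field F] (s : Set Fˣ) (hs : s.Infinite) (a : F[T;T⁻¹])
    (ha : ∀ z ∈ s, (gmPoint F z).ofConv a = 0) : a = 0 := by
  obtain ⟨n, f, hf⟩ := a.exists_T_pow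
  have heval : ∀ z : Fˣ, (gmPoint F z).ofConv (Polynomial.toLaurent f) = f.eval (z : F) := by
    intro z
    have : (gmPoint F z).ofConv.comp Polynomial.toLaurentAlg = Polynomial.aeval (z : F) := by
      ext
      simp [gmPoint_T]
    simpa using DFunLike.congr_fun this f
  have hf0 : f = 0 := by
    refine Polynomial.eq_zero_of_infinite_isRoot f ((hs.image Units.val_injective.injOn).mono ?_)
    rintro _ ⟨z, hz, rfl⟩
    change f.eval (z : F) = 0
    rw [← heval, hf, map_mul, ha z hz, zero_mul]
  rw [hf0, map_zero] at hf
  exact (LaurentPolynomial.isUnit_T (R := F) n).mul_left_eq_zero.1 hf.symm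

variable {k : Type*} {K : Type*} [Field k] [Field K] [Algebra k K] (ℓ : ℕ) [Fact ℓ.Prime]

variable (k K) in
/-- The `ℓ`-adic cyclotomic character with values in `ℚ_ℓˣ`. -/
def cyclotomicUnit : Gal(K/k) →* ℚ_[ℓ]ˣ :=
  (Units.map (PadicInt.Coe.ringHom (p := ℓ)).toMonoidHom).comp <|
    (cyclotomicCharacter K ℓ).comp (MulSemiringAction.toRingAut Gal(K/k) K)

theorem cyclotomic_apply (γ : Gal(K/k)) :
    cyclotomic ℓ k K γ = gmPoint ℚ_[ℓ] (cyclotomicUnit k K ℓ γ) := rfl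

theorem continuous_cyclotomicUnit : Continuous (cyclotomicUnit k K ℓ) :=
  (Continuous.units_map _ continuous_subtype_val).comp (cyclotomicCharacter.continuous ℓ k K)

theorem continuous_cyclotomic (a : ℚ_[ℓ][T;T⁻¹]) :
    Continuous fun γ => (cyclotomic ℓ k K γ).ofConv a := by
  induction a using LaurentPolynomial.induction_on' with
  | add p q hp hq =>
    simp only [map_add]
    exact hp.add hq
  | C_mul_T n c =>
    simp only [← LaurentPolynomial.smul_eq_C_mul, map_smul, cyclotomic_apply, gmPoint_T,
      ← Units.val_zpow_eq_zpow_val]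
    exact (Units.continuous_val.comp ((continuous_cyclotomicUnit ℓ).zpow n)).const_smul c

variable [Finite k]

variable (k) in
theorem card_zpow_ne_one {n : ℤ} (hn : n ≠ 0) : (Nat.card k : ℚ_[ℓ]) ^ n ≠ 1 := by
  have h : ((Nat.card k : ℚ) ^ n) ≠ 1 := fun h =>
    hn (zpow_right_injective₀ (a := (Nat.card k : ℚ)) (by exact_mod_cast Nat.card_pos)
      (by exact_mod_cast (Finite.one_lt_card (α := k)).ne') (h.trans (zpow_zero _).symm))
  have h' : (((Nat.card k : ℚ) ^ n : ℚ) : ℚ_[ℓ]) ≠ ((1 : ℚ) : ℚ_[ℓ]) :=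
    fun e => h (Rat.cast_injective e)
  simpa using h'

variable [IsSepClosure k K]

theorem cyclotomicUnit_frobenius (hℓ : (ℓ : k) ≠ 0) :
    (cyclotomicUnit k K ℓ (frobenius k K) : ℚ_[ℓ]) = Nat.card k := by
  have h := cyclotomicCharacter_frobenius k K ℓ hℓ
  change ((cyclotomicCharacter K ℓ (MulSemiringAction.toRingAut Gal(K/k) K (frobenius k K)) :
    ℤ_[ℓ]) : ℚ_[ℓ]) = _
  rw [h]
  simp

theorem cyclotomic_eq_zero_of_frobenius (hℓ : (ℓ : k) ≠ 0) (a : ℚ_[ℓ][T;T⁻¹])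
    (ha : ∀ n : ℕ, (cyclotomic ℓ k K (frobenius k K ^ n)).ofConv a = 0) : a = 0 := by
  refine eq_zero_of_gmPoint (Set.range fun n : ℕ => cyclotomicUnit k K ℓ (frobenius k K ^ n))
    (Set.infinite_range_of_injective ?_) a ?_
  · intro m n hmn
    have h := congrArg Units.val hmn
    simp only [map_pow, Units.val_pow_eq_pow_val, cyclotomicUnit_frobenius ℓ hℓ] at h
    exact Nat.pow_right_injective (Finite.one_lt_card (α := k)) (by exact_mod_cast h)
  · rintro _ ⟨n, rfl⟩
    exact ha n

end Points

section Cohomology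

open CategoryTheory Limits

theorem subsingleton_homology_of_forall_exists {F : Type*} [Ring F] [TopologicalSpace F]
    (C : CochainComplex (TopModuleCat.{w} F) ℕ)
    (h : ∀ σ : C.X 1, (C.d 1 2).hom σ = 0 → ∃ τ : C.X 0, (C.d 0 1).hom τ = σ) :
    Subsingleton (C.homology 1) := by
  let S := C.sc' 0 1 2
  let D : S.LeftHomologyData :=
    ⟨_, _, _, _, _, TopModuleCat.isLimitKer _, by simp, TopModuleCat.isColimitCoker _⟩
  have hD : Subsingleton D.H := by
    refine Submodule.Quotient.subsingleton_iff.2 (eq_top_iff.2 ?_)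
    rintro ⟨σ, hσ⟩ -
    obtain ⟨τ, hτ⟩ := h σ hσ
    exact ⟨τ, Subtype.ext hτ⟩
  have hZ : IsZero D.H := by
    rw [IsZero.iff_id_eq_zero]
    ext y
    exact Subsingleton.elim _ _
  have hZ' : IsZero (C.homology 1) := by
    refine HomologicalComplex.ExactAt.isZero_homology ?_
    rw [C.exactAt_iff' 0 1 2 (by simp) (by simp)]
    exact D.exact_iff.2 hZ
  refine ⟨fun x y => ?_⟩
  have := (IsZero.iff_id_eq_zero _).1 hZ'
  have hx := ConcreteCategory.congr_hom this x
  have hy := ConcreteCategory.congr_hom this y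
  exact hx.trans hy.symm

variable {F G : Type*} [Ring F] [TopologicalSpace F] [Group G] [TopologicalSpace G]
  [IsTopologicalGroup G]

open TopRep ContRepresentation

theorem d_one_apply (X : TopRep F G) (τ : C(G, X)) (g h : G) :
    ((d X 1).hom τ : C(G, C(G, X))) g h = τ h - τ g := by
  rw [hom_d_succ]
  rfl

theorem d_two_apply (X : TopRep F G) (σ : C(G, C(G, X))) (g h l : G) :
    ((d X 2).hom σ : C(G, C(G, C(G, X)))) g h l = σ h l - (σ g l - σ g h) := by
  rw [hom_d_succ]
  change σ h l - ((d X 1).hom (σ g) : C(G, C(G, X))) h l = _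
  rw [d_one_apply]

theorem subsingleton_continuousCohomology_one (X : TopRep F G) [T2Space X] (φ : G)
    (hφ : (Subgroup.zpowers φ).topologicalClosure = ⊤)
    (hcont : ∀ x : X, Continuous fun g => X.ρ g x)
    (hsurj : Function.Surjective fun x : X => X.ρ φ x - x) :
    Subsingleton (continuousCohomology 1 X) := by
  refine subsingleton_homology_of_forall_exists _ fun σ hσ => ?_
  have hd := (homogeneousCochains.d_apply X 1 σ).symm.trans (congrArg Subtype.val hσ)
  let s : C(G, C(G, X)) := σ.1
  have hs : ∀ g h l, s g l = s g h + s h l := fun g h l => by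
    have h1 : ((d X 2).hom s : C(G, C(G, C(G, X)))) = 0 := hd
    have h2 := d_two_apply X s g h l
    rw [h1] at h2
    have h3 : (0 : X) = s h l - (s g l - s g h) := h2
    rw [eq_comm, sub_eq_zero] at h3
    rw [h3, add_sub_cancel]
  have hinv : ∀ g h l, X.ρ g (s h l) = s (g * h) (g * l) := fun g h l => by
    have h1 := DFunLike.congr_fun (DFunLike.congr_fun (σ.2 g) (g * h)) (g * l)
    have h2 : X.ρ g (s (g⁻¹ * (g * h)) (g⁻¹ * (g * l))) = s (g * h) (g * l) := h1
    rwa [inv_mul_cancel_left, inv_mul_cancel_left] at h2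
  obtain ⟨x, hx⟩ := hsurj (s 1 φ)
  have hmul : ∀ g h, X.ρ (g * h) x = X.ρ g (X.ρ h x) := fun g h => by simp
  -- the cocycle vanishes on the closed subgroup generated by `φ`
  let H : Subgroup G :=
    { carrier := {g | s 1 g = X.ρ g x - x}
      one_mem' := by
        have := hs 1 1 1
        simp_all
      mul_mem' := fun {g h} hg hh => by
        change s 1 (g * h) = _
        have h1 := hinv g 1 h
        rw [mul_one, hh, map_sub] at h1
        rw [hs 1 g, ← h1, hg, hmul]
        abel
      inv_mem' := fun {g} hg => by
        change s 1 g⁻¹ = _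
        have h1 := hinv g⁻¹ 1 g
        rw [mul_one, inv_mul_cancel, hg, map_sub, ← hmul, inv_mul_cancel] at h1
        have h2 := hs 1 g⁻¹ 1
        have h3 := hs 1 1 1
        rw [left_eq_add] at h3
        rw [map_one X.ρ, one_apply_eq_self] at h1
        rw [h3, ← h1, eq_comm, add_eq_zero_iff_eq_neg, neg_sub] at h2
        exact h2 }
  have hH : H = ⊤ := by
    rw [eq_top_iff, ← hφ]
    refine Subgroup.topologicalClosure_minimal _ ?_ ?_
    · rw [Subgroup.zpowers_le]
      exact hx.symm
    · exact isClosed_eq (s 1).continuous ((hcont x).sub continuous_const)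
  have hsx : ∀ g, s 1 g = X.ρ g x - x := fun g => by
    have : g ∈ H := hH ▸ Subgroup.mem_top g
    exact this
  let t : C(G, X) := ⟨fun g => X.ρ g x, hcont x⟩
  have ht : t ∈ (resolutionX X 1).ρ.invariants := fun g => by
    refine ContinuousMap.ext fun h => ?_
    change X.ρ g (X.ρ (g⁻¹ * h) x) = X.ρ h x
    rw [← hmul, mul_inv_cancel_left]
  refine ⟨⟨t, ht⟩, Subtype.ext ((homogeneousCochains.d_apply X 0 ⟨t, ht⟩).trans ?_)⟩
  refine ContinuousMap.ext fun g => ContinuousMap.ext fun h => ?_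
  refine (d_one_apply X t g h).trans ?_
  change X.ρ h x - X.ρ g x = s g h
  have := hs 1 g h
  rw [hsx, hsx] at this
  rw [sub_eq_iff_eq_add] at this
  rw [this]
  abel

end Cohomology

section TrivialGroup

variable {F : Type*} [Field F] {A : Type*} [CommRing A] [Bialgebra F A]

theorem isProunipotent_of_eq_algebraMap_counit
    (h : ∀ a : A, a = algebraMap F A (Coalgebra.counit (R := F) a)) : IsProunipotent F A := by
  intro n δ hn
  have : NeZero n := ⟨hn.ne'⟩
  refine ⟨1, one_ne_zero, ?_⟩
  have e : Algebra.linearMap F A ∘ₗ Coalgebra.counit = LinearMap.id :=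
    LinearMap.ext fun a => (h a).symm
  have h1 := LinearMap.congr_fun δ.counit 1
  have h2 := congrArg (LinearMap.lTensor (Fin n → F) (Algebra.linearMap F A)) h1
  rw [LinearMap.comp_apply, ← LinearMap.lTensor_comp_apply, e] at h2
  simpa using h2

theorem eq_zero_of_primitive_of_eq_algebraMap_counit
    (h : ∀ a : A, a = algebraMap F A (Coalgebra.counit (R := F) a)) {f : A}
    (hf : Coalgebra.comul (R := F) f = f ⊗ₜ[F] 1 + 1 ⊗ₜ[F] f) : f = 0 := by
  have h1 := Coalgebra.rTensor_counit_comul (R := F) f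
  rw [hf, map_add, LinearMap.rTensor_tmul, LinearMap.rTensor_tmul, Bialgebra.counit_one,
    add_eq_right] at h1
  have h2 := congrArg (TensorProduct.lid F A) h1
  rw [TensorProduct.lid_tmul, map_zero, ← Algebra.algebraMap_eq_smul_one, ← h] at h2
  exact h2

/-- A prounipotent group scheme has no nontrivial characters. -/
theorem IsProunipotent.eq_one_of_isGroupLikeElem (hA : IsProunipotent F A) {t : A}
    (ht : IsGroupLikeElem F t) : t = 1 := by
  let δ : Coaction F A (Fin 1 → F) :=
    { toFun := (TensorProduct.mk F (Fin 1 → F) A).flip t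
      coassoc := by
        refine LinearMap.ext fun v => ?_
        simp [ht.comul_eq_tmul_self]
      counit := by
        refine LinearMap.ext fun v => ?_
        simp [ht.counit_eq_one] }
  obtain ⟨v, hv, h⟩ := hA 1 δ one_pos
  have hv0 : v 0 ≠ 0 := fun h0 => hv (funext fun i => by rw [Subsingleton.elim i 0, h0]; rfl)
  have h1 : v ⊗ₜ[F] t = v ⊗ₜ[F] 1 := h
  have h2 := congrArg (fun y => TensorProduct.lid F A
    (LinearMap.rTensor A (LinearMap.proj (R := F) (φ := fun _ : Fin 1 => F) 0) y)) h1
  simp only [LinearMap.rTensor_tmul, TensorProduct.lid_tmul, LinearMap.proj_apply] at h2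
  exact smul_right_injective A hv0 h2

end TrivialGroup

section Main

variable {k : Type*} {K : Type*} [Field k] [Finite k] [Field K] [Algebra k K] [IsSepClosure k K]
  (ℓ : ℕ) [Fact ℓ.Prime]

theorem gmPow_T {F : Type*} [Field F] (m n : ℤ) :
    gmPow F m (LaurentPolynomial.T n) = LaurentPolynomial.T (n * m) := by
  change AddMonoidAlgebra.mapDomain _ (AddMonoidAlgebra.single n 1) = _
  rw [AddMonoidAlgebra.mapDomain_single]
  rfl

theorem kerIdeal_eq_of_isDenseLift (hℓ : (ℓ : k) ≠ 0) {A : Type*} [CommRing A]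
    [HopfAlgebra ℚ_[ℓ] A] {π : ℚ_[ℓ][T;T⁻¹] →ₐc[ℚ_[ℓ]] A}
    {χ : Gal(K/k) →* WithConv (A →ₐ[ℚ_[ℓ]] ℚ_[ℓ])}
    (hE : IsNegativelyWeightedExtension (gmPow ℚ_[ℓ] (-2)) π)
    (hD : IsDenseLift π (cyclotomic ℓ k K) χ) :
    kerIdeal π = RingHom.ker (Bialgebra.counitAlgHom ℚ_[ℓ] A) := by
  have := isCocomm_of_dense χ hD.dense
  have hbot : homToGa π = ⊥ := by
    refine eq_bot_iff.2 (hE.negative.trans (iSup_le fun n => ?_))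
    refine (homToGaWeight_eq_bot (gmPow ℚ_[ℓ] (-2)) π n
      (gmPoint ℚ_[ℓ] (cyclotomicUnit k K ℓ (frobenius k K))).ofConv
      (χ (frobenius k K ^ (-2 : ℤ))).ofConv ?_ ?_).le
    · refine AddMonoidAlgebra.algHom_ext (fun m => ?_) (by ext)
      change (χ _).ofConv (π (LaurentPolynomial.T m)) =
        (gmPoint ℚ_[ℓ] _).ofConv (gmPow ℚ_[ℓ] (-2) (LaurentPolynomial.T m))
      rw [hD.lift, cyclotomic_apply, gmPow_T, gmPoint_T, gmPoint_T, map_zpow,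
        Units.val_zpow_eq_zpow_val, ← zpow_mul, mul_comm]
    · rw [gmPoint_T, cyclotomicUnit_frobenius ℓ hℓ]
      exact card_zpow_ne_one k ℓ n.2.ne
  have htriv := hE.prounipotent.eq_algebraMap_counit fun f hf =>
    (Submodule.eq_bot_iff _).1 hbot f hf
  refine le_antisymm ?_ fun a ha => ?_
  · exact fun a ha => (kerIdeal_isCoideal π).counit_eq_zero ha
  · rw [← Ideal.Quotient.eq_zero_iff_mem, htriv (Ideal.Quotient.mk _ a)]
    have : Coalgebra.counit (R := ℚ_[ℓ]) a = 0 := ha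
    rw [Bialgebra.Quotient.counit_mk, this, map_zero]

theorem bijective_of_isDenseLift (hℓ : (ℓ : k) ≠ 0) {A : Type*} [CommRing A]
    [HopfAlgebra ℚ_[ℓ] A] {π : ℚ_[ℓ][T;T⁻¹] →ₐc[ℚ_[ℓ]] A}
    {χ : Gal(K/k) →* WithConv (A →ₐ[ℚ_[ℓ]] ℚ_[ℓ])}
    (hE : IsNegativelyWeightedExtension (gmPow ℚ_[ℓ] (-2)) π)
    (hD : IsDenseLift π (cyclotomic ℓ k K) χ) : Function.Bijective π :=
  bijective_of_kerIdeal_eq π hE.faithfullyFlat (kerIdeal_eq_of_isDenseLift ℓ hℓ hE hD)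

theorem kerIdeal_id {F R : Type*} [Field F] [CommRing R] [HopfAlgebra F R] :
    kerIdeal (BialgHom.id F R) = RingHom.ker (Bialgebra.counitAlgHom F R) :=
  Ideal.map_id _

theorem isNegativelyWeightedExtension_id {F : Type*} [Field F] {R : Type*} [CommRing R]
    [HopfAlgebra F R] (ω : R →ₐc[F] F[T;T⁻¹]) :
    IsNegativelyWeightedExtension ω (BialgHom.id F R) := by
  have h : ∀ a : R ⧸ kerIdeal (BialgHom.id F R),
      a = algebraMap F _ (Coalgebra.counit (R := F) a) := by
    intro a
    obtain ⟨a, rfl⟩ := Ideal.Quotient.mk_surjective a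
    rw [Bialgebra.Quotient.counit_mk, ← sub_eq_zero]
    refine Ideal.Quotient.eq_zero_iff_mem.2 (?_ :
      a - algebraMap F R (Coalgebra.counit (R := F) a) ∈ _)
    rw [kerIdeal_id]
    simp [RingHom.mem_ker]
  refine ⟨.of_bijective Function.bijective_id, isProunipotent_of_eq_algebraMap_counit h, ?_⟩
  intro f hf
  rw [eq_zero_of_primitive_of_eq_algebraMap_counit h hf]
  exact zero_mem _

theorem isDenseLift_cyclotomic (hℓ : (ℓ : k) ≠ 0) :
    IsDenseLift (BialgHom.id ℚ_[ℓ] ℚ_[ℓ][T;T⁻¹]) (cyclotomic ℓ k K) (cyclotomic ℓ k K) where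
  continuous := continuous_cyclotomic ℓ
  dense a ha := cyclotomic_eq_zero_of_frobenius ℓ hℓ a fun _ => ha _
  lift _ _ := rfl

theorem isWeightedCompletion_gm (hℓ : (ℓ : k) ≠ 0) :
    IsWeightedCompletion.{0, 0, w} (gmPow ℚ_[ℓ] (-2)) (cyclotomic ℓ k K)
      (BialgHom.id ℚ_[ℓ] ℚ_[ℓ][T;T⁻¹]) (cyclotomic ℓ k K) where
  extension := isNegativelyWeightedExtension_id _
  isDenseLift := isDenseLift_cyclotomic ℓ hℓ
  universal B _ _ πB ρB hE hD := by
    let e := BialgEquiv.ofBijective πB (bijective_of_isDenseLift ℓ hℓ hE hD)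
    have he : ∀ b, πB (e.symm b) = b := fun b => e.apply_symm_apply b
    have h : ∀ γ b, (ρB γ).ofConv b = (cyclotomic ℓ k K γ).ofConv (e.symm b) := fun γ b => by
      rw [← hD.lift, he]
    refine ⟨(e.symm : B →ₐc[ℚ_[ℓ]] ℚ_[ℓ][T;T⁻¹]), h, fun φ hφ => DFunLike.ext _ _ fun b => ?_⟩
    rw [← sub_eq_zero]
    refine (isDenseLift_cyclotomic (k := k) (K := K) ℓ hℓ).dense _ fun γ => ?_
    rw [map_sub, sub_eq_zero, ← hφ γ b]
    exact h γ b

/-- If `𝔾ₘ → G` is an isomorphism, all prounipotent closed subgroups of `G` are trivial. -/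
theorem eq_ker_counit_of_isProunipotent {F : Type*} [Field F] {A : Type*} [CommRing A]
    [HopfAlgebra F A] (π : F[T;T⁻¹] →ₐc[F] A) (hπ : Function.Surjective π)
    (I : Ideal A) [I.IsHopfIdeal F] (hI : IsProunipotent F (A ⧸ I)) :
    I = RingHom.ker (Bialgebra.counitAlgHom F A) := by
  refine le_antisymm (fun a ha => ?_) fun a ha => ?_
  · exact Submodule.IsCoideal.counit_eq_zero (R := F) (I := I.restrictScalars F) ha
  · let q : F[T;T⁻¹] →ₐc[F] A ⧸ I := (Bialgebra.Quotient.mkBialgHom I).comp π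
    have hq : (q : F[T;T⁻¹] →ₐ[F] A ⧸ I) =
        (Algebra.ofId F _).comp (Bialgebra.counitAlgHom F F[T;T⁻¹]) := by
      refine AddMonoidAlgebra.algHom_ext (fun m => ?_) (by ext)
      have hm : IsGroupLikeElem F (AddMonoidAlgebra.single m 1 : F[T;T⁻¹]) :=
        AddMonoidAlgebra.isGroupLikeElem_single_one m
      have h1 := hI.eq_one_of_isGroupLikeElem (hm.map q)
      refine Eq.trans h1 ?_
      simp
    obtain ⟨p, rfl⟩ := hπ a
    have hp : Coalgebra.counit (R := F) p = 0 := by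
      rw [← CoalgHomClass.counit_comp_apply π]
      exact ha
    rw [← Ideal.Quotient.eq_zero_iff_mem]
    refine (DFunLike.congr_fun hq p).trans ?_
    change algebraMap F _ (Coalgebra.counit (R := F) p) = 0
    rw [hp, map_zero]

theorem continuous_act {F : Type*} [NontriviallyNormedField F] {A : Type*} [CommRing A]
    [Bialgebra F A] {V : Type*} [AddCommGroup V] [Module F V] [TopologicalSpace V]
    [IsTopologicalAddGroup V] [ContinuousSMul F V] (δ : Coaction F A V) {Γ : Type*}
    [TopologicalSpace Γ] (ρ : Γ → WithConv (A →ₐ[F] F))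
    (hρ : ∀ a, Continuous fun γ => (ρ γ).ofConv a) (y : V) :
    Continuous fun γ => δ.act (ρ γ) y := by
  simp only [Coaction.act, LinearMap.comp_apply]
  induction δ.toFun y with
  | zero => simpa using continuous_const
  | tmul v a =>
    simp only [LinearMap.lTensor_tmul, LinearEquiv.coe_coe, TensorProduct.rid_tmul]
    exact (hρ a).smul continuous_const
  | add s t hs ht =>
    simp only [map_add]
    exact hs.add ht

/-- A vector fixed by Frobenius in a `𝔾ₘ`-module is fixed by `𝔾ₘ`. -/
theorem toFun_eq_of_act_frobenius (hℓ : (ℓ : k) ≠ 0) {V : Type*} [AddCommGroup V]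
    [Module ℚ_[ℓ] V] (δ : Coaction ℚ_[ℓ] ℚ_[ℓ][T;T⁻¹] V) {y : V}
    (hy : δ.act (cyclotomic ℓ k K (frobenius k K)) y = y) : δ.toFun y = y ⊗ₜ 1 := by
  rw [← sub_eq_zero]
  refine tensor_eq_zero_of_forall_lTensor
    (fun n : ℕ => (cyclotomic ℓ k K (frobenius k K ^ n)).ofConv.toLinearMap)
    (cyclotomic_eq_zero_of_frobenius ℓ hℓ) _ fun n => ?_
  have h : δ.act (cyclotomic ℓ k K (frobenius k K ^ n)) y = y := by
    induction n with
    | zero => rw [pow_zero, map_one, Coaction.act_one, LinearMap.id_apply]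
    | succ n ih => rw [pow_succ, map_mul, Coaction.act_mul, LinearMap.comp_apply, hy, ih]
  apply (TensorProduct.rid ℚ_[ℓ] V).injective
  rw [map_sub, map_sub, map_zero, sub_eq_zero]
  refine Eq.trans h ?_
  simp

theorem subsingleton_continuousCohomology_cyclotomic {K : Type u} [Field K] [Algebra k K]
    [IsSepClosure k K] (hℓ : (ℓ : k) ≠ 0) {V : Type (max u x)} [AddCommGroup V] [Module ℚ_[ℓ] V]
    [Module.Finite ℚ_[ℓ] V] [TopologicalSpace V] [IsTopologicalAddGroup V]
    [ContinuousSMul ℚ_[ℓ] V] [T2Space V] (δ : Coaction ℚ_[ℓ] ℚ_[ℓ][T;T⁻¹] V)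
    (hδ : δ.weightSpace (gmPow ℚ_[ℓ] (-2)) 0 = ⊥) :
    Subsingleton (continuousCohomology 1 (δ.topRep (cyclotomic ℓ k K))) := by
  have : T2Space (δ.topRep (cyclotomic ℓ k K)) := inferInstanceAs (T2Space V)
  refine subsingleton_continuousCohomology_one _ (frobenius k K)
    (topologicalClosure_zpowers_frobenius k K)
    (fun y => continuous_act δ _ (continuous_cyclotomic ℓ) y) ?_
  let f : V →ₗ[ℚ_[ℓ]] V := δ.act (cyclotomic ℓ k K (frobenius k K)) - LinearMap.id
  have hf : Function.Injective f := by
    rw [← LinearMap.ker_eq_bot, eq_bot_iff, ← hδ]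
    intro y hy
    have h := toFun_eq_of_act_frobenius ℓ hℓ δ (sub_eq_zero.1 hy)
    change LinearMap.lTensor V _ (δ.toFun y) = _
    rw [h, LinearMap.lTensor_tmul, AlgHom.toLinearMap_apply, map_one, LaurentPolynomial.T_zero]
  exact LinearMap.injective_iff_surjective.1 hf

end Main

end WeightedCompletion

end

theorem mainTheorem5 {k : Type*} {K : Type u} [Field k] [Finite k] [Field K] [Algebra k K]
    [IsSepClosure k K] (ℓ : ℕ) [Fact ℓ.Prime] (hℓ : (ℓ : k) ≠ 0) :
    -- `𝔾ₘ`, with the cyclotomic character, is the weighted completion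
    WeightedCompletion.IsWeightedCompletion.{0, 0, w} (WeightedCompletion.gmPow ℚ_[ℓ] (-2))
        (WeightedCompletion.cyclotomic ℓ k K) (BialgHom.id ℚ_[ℓ] ℚ_[ℓ][T;T⁻¹])
        (WeightedCompletion.cyclotomic ℓ k K) ∧
    -- for every weighted completion `𝒜`, the projection `𝒜 → 𝔾ₘ` is an isomorphism, and its
    -- kernel and all prounipotent closed subgroups of `𝒜` are trivial
    (∀ (A : Type v) [CommRing A] [HopfAlgebra ℚ_[ℓ] A] (π : ℚ_[ℓ][T;T⁻¹] →ₐc[ℚ_[ℓ]] A)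
      (χ : Gal(K/k) →* WithConv (A →ₐ[ℚ_[ℓ]] ℚ_[ℓ])),
      WeightedCompletion.IsWeightedCompletion.{0, v, w} (WeightedCompletion.gmPow ℚ_[ℓ] (-2))
        (WeightedCompletion.cyclotomic ℓ k K) π χ →
      Function.Bijective π ∧
      WeightedCompletion.kerIdeal π = RingHom.ker (Bialgebra.counitAlgHom ℚ_[ℓ] A) ∧
      ∀ (I : Ideal A) [I.IsHopfIdeal ℚ_[ℓ]], WeightedCompletion.IsProunipotent ℚ_[ℓ] (A ⧸ I) →
        I = RingHom.ker (Bialgebra.counitAlgHom ℚ_[ℓ] A)) ∧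
    -- the vanishing of continuous cohomology
    (∀ (V : Type (max u x)) [AddCommGroup V] [Module ℚ_[ℓ] V] [Module.Finite ℚ_[ℓ] V]
      [TopologicalSpace V] [IsTopologicalAddGroup V] [ContinuousSMul ℚ_[ℓ] V] [T2Space V]
      (δ : WeightedCompletion.Coaction ℚ_[ℓ] ℚ_[ℓ][T;T⁻¹] V),
      δ.weightSpace (WeightedCompletion.gmPow ℚ_[ℓ] (-2)) 0 = ⊥ →
      Subsingleton
        (continuousCohomology 1 (δ.topRep (WeightedCompletion.cyclotomic ℓ k K)))) := by
  refine ⟨WeightedCompletion.isWeightedCompletion_gm ℓ hℓ, fun A _ _ π χ h => ?_,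
    fun V _ _ _ _ _ _ _ δ hδ =>
      WeightedCompletion.subsingleton_continuousCohomology_cyclotomic ℓ hℓ δ hδ⟩
  have hb := WeightedCompletion.bijective_of_isDenseLift ℓ hℓ h.extension h.isDenseLift
  exact ⟨hb, WeightedCompletion.kerIdeal_eq_of_isDenseLift ℓ hℓ h.extension h.isDenseLift,
    fun I _ hI => WeightedCompletion.eq_ker_counit_of_isProunipotent π hb.2 I hI⟩
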